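/- Let $f_1,f_2:\mathbb{R}^n\to\mathbb{R}^n$ be $C^1$ vector fields, and let $x_0$ be a stasis point, i.e. $f_1(x_0)\cdot f_2(x_0)=-|f_1(x_0)|\,|f_2(x_0)|$, with $k_1f_1(x_0)+k_2f_2(x_0)=0$ for some real $k_1,k_2>0$. Suppose that the derivative of the map $k_1f_1+k_2f_2$ at $x_0$ is non-singular. Then there are arbitrarily small two-cycles of the inclusion $x'\in\{f_1(x),f_2(x)\}$ arbitrarily near $x_0$. That is, for every $\varepsilon>0$ there are times $0<\kappa<\delta<\varepsilon$ and a continuous, $\delta$-periodic curve $x:\mathbb{R}\to\mathbb{R}^n$ such that $x'(t)=f_1(x(t))$ for $0\le t\le\kappa$ and $x'(t)=f_2(x(t))$ for $\kappa\le t\le\delta$ (with one-sided derivatives at the end points of these two intervals), and $|x(t)-x_0|<\varepsilon$ for all $t$. -/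

import Mathlib

/-- `x₀` is a stasis point of the vector fields `f₁`, `f₂`: the two fields are anti-parallel
there, `f₁(x₀) · f₂(x₀) = -|f₁(x₀)| |f₂(x₀)|`. -/
def IsStasisPoint {n : ℕ} (f₁ f₂ : EuclideanSpace ℝ (Fin n) → EuclideanSpace ℝ (Fin n))
    (x₀ : EuclideanSpace ℝ (Fin n)) : Prop :=
  inner ℝ (f₁ x₀) (f₂ x₀) = -(‖f₁ x₀‖ * ‖f₂ x₀‖)

/-- `x` is a two-cycle of `x' ∈ {f₁(x), f₂(x)}` with switching time `κ` and period `δ`: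
a continuous `δ`-periodic curve with `x' = f₁(x)` on the first piece `[0, κ]` and `x' = f₂(x)` on
the second piece `[κ, δ]`. The derivatives at the ends of the two pieces are one-sided, so the
curve is `C¹` on each closed piece (for continuous fields) and may have corners at the switches. -/
structure IsTwoCycle {n : ℕ} (f₁ f₂ : EuclideanSpace ℝ (Fin n) → EuclideanSpace ℝ (Fin n))
    (κ δ : ℝ) (x : ℝ → EuclideanSpace ℝ (Fin n)) : Prop where
  switch_pos : 0 < κ
  switch_lt : κ < δ
  continuous : Continuous x
  periodic : Function.Periodic x δ
  first : IsIntegralCurveOn x (fun _ => f₁) (Set.Icc 0 κ)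
  second : IsIntegralCurveOn x (fun _ => f₂) (Set.Icc κ δ)

/-!
Let `Φ t` and `Ψ t` be the local flows of `f₁` and `f₂`. Following `f₁` for time `k₁ s` and then
`f₂` for time `k₂ s` closes up exactly at the fixed points of `P s = Ψ (k₂ s) ∘ Φ (k₁ s)`, so it is
enough to find a fixed point of `P s` near `x₀` for every small `s > 0`.

Fixed points of `P s` are zeros of `G s x = s⁻¹ • (P s x - x)`, and `G s` is close to
`F = k₁ • f₁ + k₂ • f₂` for small `s`. Since `F x₀ = 0` and `B = F'(x₀)` is invertible, a
quantitative inverse function theorem gives a zero of `G s`, provided that `G s - B` has a small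
Lipschitz constant near `x₀` and that `G s x₀ → 0`. The flow need not be differentiated in the
initial point: the Lipschitz bound only uses the strict differentiability of the fields at `x₀` and
the Lipschitz dependence of the flows on the initial point.

The predicate `IsEulerStepAt` records these two estimates for a family of maps. Flows of `C¹` fields
satisfy it (`ContDiffAt.exists_flow_isEulerStepAt`), it is stable under rescaling of time and under
composition (`IsEulerStepAt.comp_mul_left`, `IsEulerStepAt.comp`), and it gives the fixed points
(`IsEulerStepAt.eventually_exists_fixedPt`). The two arcs through the fixed point are glued and
extended periodically in `exists_isTwoCycle`.
-/

open Filter Topology Set Metric Asymptotics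
open scoped NNReal

section BanachSpace

/-! ### Families of maps that are Euler steps to first order -/

variable {E : Type*} [NormedAddCommGroup E] [NormedSpace ℝ E]

/-- The family of maps `Φ s`, `s ≥ 0`, looks like one Euler step `x ↦ x + s • (v + A (x - x₀))`
near `x₀` as `s → 0⁺`. The error in the increments `Φ s x - Φ s y` is measured against
`s • (x - y)`, so that dividing by `s` leaves an error with small Lipschitz constant; the value
at the centre is only controlled through its right derivative in `s`. -/
structure IsEulerStepAt (Φ : ℝ → E → E) (x₀ v : E) (A : E →L[ℝ] E) : Prop where
  map_zero : Φ 0 x₀ = x₀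
  hasDerivWithinAt : HasDerivWithinAt (fun s => Φ s x₀) v (Ici 0) 0
  increments : (fun p : ℝ × E × E =>
      Φ p.1 p.2.1 - Φ p.1 p.2.2 - (p.2.1 - p.2.2) - p.1 • A (p.2.1 - p.2.2))
    =o[𝓝[≥] 0 ×ˢ (𝓝 x₀ ×ˢ 𝓝 x₀)] fun p => p.1 • (p.2.1 - p.2.2)

namespace IsEulerStepAt

variable {Φ Ψ : ℝ → E → E} {x₀ v w : E} {A C : E →L[ℝ] E}

/-- The increments of `Φ s` differ from those of the identity by `O(s)`, uniformly. -/
theorem isBigO_increments_sub (h : IsEulerStepAt Φ x₀ v A) :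
    (fun p : ℝ × E × E => Φ p.1 p.2.1 - Φ p.1 p.2.2 - (p.2.1 - p.2.2))
      =O[𝓝[≥] 0 ×ˢ (𝓝 x₀ ×ˢ 𝓝 x₀)] fun p => p.1 • (p.2.1 - p.2.2) := by
  have hA : (fun p : ℝ × E × E => p.1 • A (p.2.1 - p.2.2))
      =O[𝓝[≥] 0 ×ˢ (𝓝 x₀ ×ˢ 𝓝 x₀)] fun p => p.1 • (p.2.1 - p.2.2) :=
    (isBigO_refl _ _).smul (A.isBigO_comp _ _)
  simpa using h.increments.isBigO.add hA

theorem isLittleO_fst_smul :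
    (fun p : ℝ × E × E => p.1 • (p.2.1 - p.2.2)) =o[𝓝[≥] 0 ×ˢ (𝓝 x₀ ×ˢ 𝓝 x₀)]
      fun p => p.2.1 - p.2.2 := by
  have h1 : (fun p : ℝ × E × E => p.1) =o[𝓝[≥] 0 ×ˢ (𝓝 x₀ ×ˢ 𝓝 x₀)] fun _ => (1 : ℝ) :=
    (isLittleO_one_iff ℝ).2 ((tendsto_nhdsWithin_iff.1 tendsto_id).1.comp tendsto_fst)
  simpa using h1.smul_isBigO (isBigO_refl (fun p : ℝ × E × E => p.2.1 - p.2.2) _)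

/-- The maps `Φ s` are uniformly Lipschitz near `x₀`. -/
theorem isBigO_increments (h : IsEulerStepAt Φ x₀ v A) :
    (fun p : ℝ × E × E => Φ p.1 p.2.1 - Φ p.1 p.2.2)
      =O[𝓝[≥] 0 ×ˢ (𝓝 x₀ ×ˢ 𝓝 x₀)] fun p => p.2.1 - p.2.2 := by
  simpa using (h.isBigO_increments_sub.trans isLittleO_fst_smul.isBigO).add (isBigO_refl _ _)

theorem tendsto_center (h : IsEulerStepAt Φ x₀ v A) :
    Tendsto (fun s => Φ s x₀) (𝓝[≥] 0) (𝓝 x₀) := by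
  simpa [ContinuousWithinAt, h.map_zero] using h.hasDerivWithinAt.continuousWithinAt

theorem tendsto (h : IsEulerStepAt Φ x₀ v A) :
    Tendsto (fun p : ℝ × E => Φ p.1 p.2) (𝓝[≥] 0 ×ˢ 𝓝 x₀) (𝓝 x₀) := by
  have hk : Tendsto (fun p : ℝ × E => (p.1, p.2, x₀)) (𝓝[≥] 0 ×ˢ 𝓝 x₀)
      (𝓝[≥] 0 ×ˢ (𝓝 x₀ ×ˢ 𝓝 x₀)) :=
    tendsto_fst.prodMk (tendsto_snd.prodMk tendsto_const_nhds)
  have h1 := h.isBigO_increments.comp_tendsto hk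
  have h2 : Tendsto (fun p : ℝ × E => Φ p.1 p.2 - Φ p.1 x₀) (𝓝[≥] 0 ×ˢ 𝓝 x₀) (𝓝 0) := by
    refine h1.trans_tendsto ?_
    simpa [Function.comp_def] using (tendsto_snd (f := 𝓝[≥] (0 : ℝ)) (g := 𝓝 x₀)).sub_const x₀
  simpa using h2.add (h.tendsto_center.comp tendsto_fst)

theorem exists_forall_mem (h : IsEulerStepAt Φ x₀ v A) {U : Set E} (hU : U ∈ 𝓝 x₀) :
    ∃ τ > 0, ∃ V ∈ 𝓝 x₀, ∀ s ∈ Icc 0 τ, ∀ x ∈ V, Φ s x ∈ U := by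
  obtain ⟨S, hS, V, hV, hSV⟩ := mem_prod_iff.1 (h.tendsto hU)
  obtain ⟨τ, hτ, hτS⟩ := mem_nhdsGE_iff_exists_Icc_subset.1 hS
  exact ⟨τ, hτ, V, hV, fun s hs x hx => hSV (mk_mem_prod (hτS hs) hx)⟩

/-- Reparametrising time by a factor `k` multiplies the velocity and its derivative by `k`. -/
theorem comp_mul_left (h : IsEulerStepAt Φ x₀ v A) {k : ℝ} (hk : 0 ≤ k) :
    IsEulerStepAt (fun s => Φ (k * s)) x₀ (k • v) (k • A) where
  map_zero := by simpa using h.map_zero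
  hasDerivWithinAt := by
    have hm : HasDerivWithinAt (fun s : ℝ => k * s) k (Ici 0) 0 := by
      simpa using (hasDerivWithinAt_id (0 : ℝ) (Ici 0)).const_mul k
    refine HasDerivWithinAt.scomp (g₁ := fun s => Φ s x₀) (t' := Ici 0) (0 : ℝ) ?_ hm
      fun s hs => mul_nonneg hk hs
    simpa using h.hasDerivWithinAt
  increments := by
    have hm : Tendsto (fun s : ℝ => k * s) (𝓝[≥] 0) (𝓝[≥] 0) := by
      refine tendsto_nhdsWithin_iff.2 ⟨?_, ?_⟩
      · simpa using ((continuous_const_mul k).tendsto 0).mono_left nhdsWithin_le_nhds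
      · filter_upwards [self_mem_nhdsWithin] with s hs using mul_nonneg hk hs
    have h1 := h.increments.comp_tendsto (hm.prodMap (tendsto_id (x := 𝓝 x₀ ×ˢ 𝓝 x₀)))
    have h2 : (fun p : ℝ × E × E => (k * p.1) • (p.2.1 - p.2.2))
        =O[𝓝[≥] 0 ×ˢ (𝓝 x₀ ×ˢ 𝓝 x₀)] fun p => p.1 • (p.2.1 - p.2.2) := by
      simp_rw [mul_smul]
      exact (isBigO_refl _ _).const_smul_left k
    refine (h1.trans_isBigO h2).congr_left fun p => ?_
    simp [mul_smul, smul_comm k]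

/-- To first order, performing two Euler steps in succession adds up the velocities and their
derivatives. -/
theorem comp (hΨ : IsEulerStepAt Ψ x₀ w C) (hΦ : IsEulerStepAt Φ x₀ v A) :
    IsEulerStepAt (fun s x => Ψ s (Φ s x)) x₀ (v + w) (A + C) := by
  have hk : Tendsto (fun p : ℝ × E × E => (p.1, Φ p.1 p.2.1, Φ p.1 p.2.2))
      (𝓝[≥] 0 ×ˢ (𝓝 x₀ ×ˢ 𝓝 x₀)) (𝓝[≥] 0 ×ˢ (𝓝 x₀ ×ˢ 𝓝 x₀)) :=
    tendsto_fst.prodMk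
      ((hΦ.tendsto.comp (tendsto_fst.prodMk (tendsto_fst.comp tendsto_snd))).prodMk
        (hΦ.tendsto.comp (tendsto_fst.prodMk (tendsto_snd.comp tendsto_snd))))
  refine ⟨by simp [hΦ.map_zero, hΨ.map_zero], ?_, ?_⟩
  · -- `Ψ s (Φ s x₀)` and `Ψ s x₀ + (Φ s x₀ - x₀)` differ by `o(s)`
    have hc : Tendsto (fun s : ℝ => (s, Φ s x₀, x₀)) (𝓝[≥] 0)
        (𝓝[≥] 0 ×ˢ (𝓝 x₀ ×ˢ 𝓝 x₀)) :=
      tendsto_id.prodMk (hΦ.tendsto_center.prodMk tendsto_const_nhds)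
    have h1 := hΨ.isBigO_increments_sub.comp_tendsto hc
    have h2 : (fun s : ℝ => s • (Φ s x₀ - x₀)) =o[𝓝[≥] 0] fun s => s := by
      have : (fun s : ℝ => Φ s x₀ - x₀) =o[𝓝[≥] 0] fun _ => (1 : ℝ) :=
        (isLittleO_one_iff ℝ).2 (by simpa using hΦ.tendsto_center.sub_const x₀)
      simpa using (isBigO_refl (fun s : ℝ => s) _).smul_isLittleO this
    have h3 := hΦ.hasDerivWithinAt.add hΨ.hasDerivWithinAt
    rw [hasDerivWithinAt_iff_isLittleO] at h3 ⊢
    simp only [sub_zero] at h3 ⊢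
    refine (h3.add (h1.trans_isLittleO h2)).congr_left fun s => ?_
    simp only [Function.comp_apply, Pi.add_apply, hΦ.map_zero, hΨ.map_zero]
    abel
  · have h1 := (hΨ.increments.comp_tendsto hk).trans_isBigO
      ((isBigO_refl (fun p : ℝ × E × E => p.1) _).smul hΦ.isBigO_increments)
    have h2 : (fun p : ℝ × E × E =>
        p.1 • C (Φ p.1 p.2.1 - Φ p.1 p.2.2 - (p.2.1 - p.2.2)))
        =o[𝓝[≥] 0 ×ˢ (𝓝 x₀ ×ˢ 𝓝 x₀)] fun p => p.1 • (p.2.1 - p.2.2) :=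
      (isBigO_refl (fun p : ℝ × E × E => p.1) _).smul_isLittleO
        (((C.isBigO_comp _ _).trans hΦ.isBigO_increments_sub).trans_isLittleO isLittleO_fst_smul)
    refine ((h1.add hΦ.increments).add h2).congr_left fun p => ?_
    simp only [Function.comp_apply, map_sub, smul_sub, add_apply, smul_add]
    abel

/-- If the velocity at `x₀` vanishes and its derivative is invertible, then `Φ s` has fixed points
near `x₀` for all small `s > 0`: the maps `x ↦ s⁻¹ • (Φ s x - x)` are uniformly invertible near
`x₀`, and their values at `x₀` tend to `0`. -/
theorem eventually_exists_fixedPt [CompleteSpace E] {B : E ≃L[ℝ] E}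
    (h : IsEulerStepAt Φ x₀ 0 (B : E →L[ℝ] E)) {ρ : ℝ} (hρ : 0 < ρ) :
    ∀ᶠ s in 𝓝[>] 0, ∃ x ∈ closedBall x₀ ρ, Φ s x = x := by
  cases subsingleton_or_nontrivial E
  · exact Eventually.of_forall fun s => ⟨x₀, mem_closedBall_self hρ.le, Subsingleton.elim _ _⟩
  -- `N = ‖B⁻¹‖`, and any `c < N⁻¹` is an admissible Lipschitz constant for the error
  set N : ℝ≥0 := B.toNonlinearRightInverse.nnnorm
  have hNpos : 0 < N := B.nnnorm_symm_pos
  obtain ⟨c, hc0, hcN⟩ : ∃ c : ℝ≥0, 0 < c ∧ c < N⁻¹ := exists_between (inv_pos.2 hNpos)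
  have hinc := h.increments.def (NNReal.coe_pos.2 hc0)
  obtain ⟨S, hS, U, hU, hSU⟩ := mem_prod_iff.1 hinc
  obtain ⟨V, hV, hVU⟩ := mem_prod_same_iff.1 hU
  obtain ⟨r, hr, hrV⟩ := nhds_basis_closedBall.mem_iff.1 hV
  set R := min ρ r
  have hR : 0 < R := lt_min hρ hr
  have hslope : Tendsto (fun s : ℝ => s⁻¹ • (Φ s x₀ - x₀)) (𝓝[>] 0) (𝓝 0) := by
    have := h.hasDerivWithinAt.mono Ioi_subset_Ici_self
    rw [hasDerivWithinAt_iff_tendsto_slope' (by simp)] at this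
    simpa [slope_fun_def, h.map_zero] using this
  have hgap : 0 < ((N : ℝ)⁻¹ - c) * R := by
    refine mul_pos (sub_pos.2 ?_) hR
    exact_mod_cast hcN
  filter_upwards [hslope (closedBall_mem_nhds 0 hgap), nhdsWithin_mono _ Ioi_subset_Ici_self hS,
    self_mem_nhdsWithin] with s hs hsS hs0
  have hs0 : 0 < s := hs0
  have happ : ApproximatesLinearOn (fun x => s⁻¹ • (Φ s x - x)) (B : E →L[ℝ] E)
      (closedBall x₀ R) c := by
    refine fun x hx y hy => ?_
    have hV' : closedBall x₀ R ⊆ V := (closedBall_subset_closedBall (min_le_right _ _)).trans hrV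
    have hxy := hSU (mk_mem_prod hsS (hVU (mk_mem_prod (hV' hx) (hV' hy))))
    have hxy : ‖Φ s x - Φ s y - (x - y) - s • B (x - y)‖ ≤ c * ‖s • (x - y)‖ := hxy
    rw [norm_smul, Real.norm_of_nonneg hs0.le] at hxy
    have heq : s⁻¹ • (Φ s x - x) - s⁻¹ • (Φ s y - y) - B (x - y)
        = s⁻¹ • (Φ s x - Φ s y - (x - y) - s • B (x - y)) := by
      rw [smul_sub s⁻¹ (Φ s x - Φ s y - (x - y)), inv_smul_smul₀ hs0.ne', ← smul_sub]
      congr 2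
      abel
    calc _ = s⁻¹ * ‖Φ s x - Φ s y - (x - y) - s • B (x - y)‖ := by
          simp only [ContinuousLinearEquiv.coe_coe]
          rw [heq, norm_smul, Real.norm_of_nonneg (inv_nonneg.2 hs0.le)]
      _ ≤ s⁻¹ * (c * (s * ‖x - y‖)) := by gcongr
      _ = c * ‖x - y‖ := by field_simp
  obtain ⟨x, hx, hx0⟩ := happ.surjOn_closedBall_of_nonlinearRightInverse
    B.toNonlinearRightInverse hR.le Subset.rfl
    (show (0 : E) ∈ _ by rwa [mem_closedBall_comm])
  refine ⟨x, closedBall_subset_closedBall (min_le_left _ _) hx, sub_eq_zero.1 ?_⟩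
  simpa [hs0.ne'] using hx0

end IsEulerStepAt

/-! ### Flows of continuously differentiable vector fields -/

/-- A `C¹` vector field has a local forward flow near any point `x₀`, and this flow is one Euler
step for the field to first order in time. -/
theorem ContDiffAt.exists_flow_isEulerStepAt [CompleteSpace E] {f : E → E} {x₀ : E}
    (hf : ContDiffAt ℝ 1 f x₀) :
    ∃ Φ : ℝ → E → E, ∃ r > 0, ∃ T > 0,
      (∀ x ∈ closedBall x₀ r, Φ 0 x = x ∧
        IsIntegralCurveOn (fun t => Φ t x) (fun _ => f) (Icc 0 T)) ∧
      IsEulerStepAt Φ x₀ (f x₀) (fderiv ℝ f x₀) := by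
  obtain ⟨ε, hε, a, r, L, K, hr, hpl⟩ := IsPicardLindelof.of_contDiffAt_one hf
  obtain ⟨α, hα, M, hM⟩ :=
    (hpl 0).exists_forall_mem_closedBall_eq_hasDerivWithinAt_lipschitzOnWith
  simp only [zero_sub, zero_add] at hα hM
  have hsub : Icc 0 ε ⊆ Icc (-ε) ε := Icc_subset_Icc_left (by linarith)
  have hx₀r : x₀ ∈ closedBall x₀ (r : ℝ) := mem_closedBall_self r.2
  have hder : ∀ x ∈ closedBall x₀ (r : ℝ), ∀ t ∈ Icc 0 ε,
      HasDerivWithinAt (α x) (f (α x t)) (Icc 0 ε) t :=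
    fun x hx t ht => ((hα x hx).2 t (hsub ht)).mono hsub
  have hcont : ContinuousOn (Function.uncurry α) (closedBall x₀ (r : ℝ) ×ˢ Icc 0 ε) :=
    continuousOn_prod_of_continuousOn_lipschitzOnWith _ M
      (fun x hx => HasDerivWithinAt.continuousOn (hder x hx)) fun t ht => hM t (hsub ht)
  have hlim : Tendsto (fun p : ℝ × E => α p.2 p.1) (𝓝[≥] 0 ×ˢ 𝓝 x₀) (𝓝 x₀) := by
    have h0 : (x₀, (0 : ℝ)) ∈ closedBall x₀ (r : ℝ) ×ˢ Icc 0 ε := ⟨hx₀r, by simp [hε.le]⟩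
    have h1 := hcont _ h0
    rw [ContinuousWithinAt, nhdsWithin_prod_eq, nhdsWithin_Icc_eq_nhdsGE hε,
      nhdsWithin_eq_nhds.2 (closedBall_mem_nhds x₀ (NNReal.coe_pos.2 hr)),
      Function.uncurry_apply_pair, (hα x₀ hx₀r).1] at h1
    exact h1.comp (tendsto_snd.prodMk tendsto_fst)
  refine ⟨fun t x => α x t, r, hr, ε, hε, fun x hx => ⟨(hα x hx).1, hder x hx⟩,
    (hα x₀ hx₀r).1, ?_, ?_⟩
  · have := hder x₀ hx₀r 0 (by simp [hε.le])
    rw [(hα x₀ hx₀r).1] at this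
    exact this.mono_of_mem_nhdsWithin (Icc_mem_nhdsGE hε)
  · set A := fderiv ℝ f x₀
    have hstrict : HasStrictFDerivAt f A x₀ := hf.hasStrictFDerivAt one_ne_zero
    refine isLittleO_iff.2 fun η hη => ?_
    -- the error at time `t ≤ τ` is at most `(c * M + ‖A‖ * (c + ‖A‖) * M * τ) * t * ‖x - y‖`;
    -- choose `c`, and then `τ ≤ δ`, to make each summand at most `η / 2`
    obtain ⟨c, hc, hcM⟩ : ∃ c : ℝ, 0 < c ∧ c * M ≤ η / 2 := by
      refine ⟨η / 2 / (M + 1), by positivity, ?_⟩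
      rw [div_mul_eq_mul_div, div_le_iff₀ (by positivity)]
      nlinarith [M.2]
    obtain ⟨δ, hδ, hδM⟩ : ∃ δ : ℝ, 0 < δ ∧ ‖A‖ * ((c + ‖A‖) * M * δ) ≤ η / 2 := by
      refine ⟨η / 2 / (‖A‖ * ((c + ‖A‖) * M) + 1), by positivity, ?_⟩
      rw [← mul_assoc, mul_div_assoc', div_le_iff₀ (by positivity)]
      nlinarith [show 0 ≤ ‖A‖ * ((c + ‖A‖) * M) by positivity]
    obtain ⟨U, hU, hUf⟩ := mem_prod_same_iff.1 
      (nhds_prod_eq (x := x₀) (y := x₀) ▸ hstrict.isLittleO.def hc)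
    obtain ⟨S, hS, V, hV, hSV⟩ := mem_prod_iff.1 (hlim hU)
    obtain ⟨τ₀, hτ₀, hτS⟩ := (mem_nhdsGE_iff_exists_Icc_subset).1 hS
    have hτ₀ : 0 < τ₀ := hτ₀
    set τ := min τ₀ (min ε δ)
    have hτ : 0 < τ := lt_min hτ₀ (lt_min hε hδ)
    have hVr : V ∩ closedBall x₀ (r : ℝ) ∈ 𝓝 x₀ :=
      inter_mem hV (closedBall_mem_nhds x₀ (NNReal.coe_pos.2 hr))
    filter_upwards [prod_mem_prod (Icc_mem_nhdsGE hτ) (prod_mem_prod hVr hVr)]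
    rintro ⟨t, x, y⟩ ⟨ht, hx, hy⟩
    simp only at ht hx hy ⊢
    have hτε : Icc 0 τ ⊆ Icc 0 ε :=
      Icc_subset_Icc_right ((min_le_right _ _).trans (min_le_left _ _))
    have hfd : ∀ u ∈ Icc 0 τ, ‖f (α x u) - f (α y u) - A (α x u - α y u)‖
        ≤ c * ‖α x u - α y u‖ := fun u hu => by
      have huS : u ∈ S := hτS ⟨hu.1, hu.2.trans (min_le_left _ _)⟩
      exact hUf (mk_mem_prod (hSV (mk_mem_prod huS hx.1)) (hSV (mk_mem_prod huS hy.1)))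
    have hlip : ∀ u ∈ Icc 0 τ, ‖α x u - α y u‖ ≤ M * ‖x - y‖ := fun u hu =>
      (hM u (hsub (hτε hu))).norm_sub_le hx.2 hy.2
    have hd : ∀ u ∈ Icc 0 τ, HasDerivWithinAt (fun u => α x u - α y u)
        (f (α x u) - f (α y u)) (Icc 0 τ) u := fun u hu =>
      ((hder x hx.2 u (hτε hu)).sub (hder y hy.2 u (hτε hu))).mono hτε
    have h0 : α x 0 - α y 0 = x - y := by rw [(hα x hx.2).1, (hα y hy.2).1]
    -- the difference of two trajectories moves by `O(t ‖x - y‖)`, which makes it legitimate to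
    -- replace it by `x - y` in the argument of `A`
    have hdrift : ∀ u ∈ Icc 0 τ,
        ‖α x u - α y u - (x - y)‖ ≤ (c + ‖A‖) * (M * ‖x - y‖) * u := fun u hu => by
      have := norm_image_sub_le_of_norm_deriv_le_segment' hd
        (C := (c + ‖A‖) * (M * ‖x - y‖)) (fun w hw => ?_) u hu
      · simpa only [h0, sub_zero] using this
      · have hw := Ico_subset_Icc_self hw
        calc ‖f (α x w) - f (α y w)‖
            ≤ ‖f (α x w) - f (α y w) - A (α x w - α y w)‖ + ‖A (α x w - α y w)‖ :=
              norm_le_norm_sub_add _ _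
          _ ≤ c * ‖α x w - α y w‖ + ‖A‖ * ‖α x w - α y w‖ := by
              gcongr
              exacts [hfd w hw, A.le_opNorm _]
          _ = (c + ‖A‖) * ‖α x w - α y w‖ := by ring
          _ ≤ (c + ‖A‖) * (M * ‖x - y‖) := by gcongr; exact hlip w hw
    have hd' : ∀ u ∈ Icc 0 τ, HasDerivWithinAt (fun u => α x u - α y u - u • A (x - y))
        (f (α x u) - f (α y u) - A (x - y)) (Icc 0 τ) u := fun u hu => by
      simpa only [one_smul] using! (hd u hu).sub ((hasDerivWithinAt_id u _).smul_const (A (x - y)))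
    have hmain := norm_image_sub_le_of_norm_deriv_le_segment' hd'
      (C := η * ‖x - y‖) (fun w hw => ?_) t ht
    · rw [norm_smul, Real.norm_of_nonneg ht.1]
      simp only [h0, zero_smul, sub_zero] at hmain
      calc _ = ‖α x t - α y t - t • A (x - y) - (x - y)‖ := by congr 1; abel
        _ ≤ _ := hmain
        _ = _ := by ring
    · have hw := Ico_subset_Icc_self hw
      have hwδ : w ≤ δ := hw.2.trans ((min_le_right _ _).trans (min_le_right _ _))
      calc ‖f (α x w) - f (α y w) - A (x - y)‖
          = ‖(f (α x w) - f (α y w) - A (α x w - α y w)) + A (α x w - α y w - (x - y))‖ := by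
            congr 1
            simp only [map_sub]
            abel
        _ ≤ c * (M * ‖x - y‖) + ‖A‖ * ((c + ‖A‖) * (M * ‖x - y‖) * δ) := by
            refine (norm_add_le _ _).trans (add_le_add ((hfd w hw).trans ?_)
              ((A.le_opNorm _).trans ?_))
            · gcongr
              exact hlip w hw
            · gcongr
              refine (hdrift w hw).trans ?_
              gcongr
        _ = (c * M + ‖A‖ * ((c + ‖A‖) * M * δ)) * ‖x - y‖ := by ring
        _ ≤ η * ‖x - y‖ := by gcongr; linarith

end BanachSpace

/-! ### Two-cycles -/

/-- Two arcs of integral curves, of durations `κ` and `l`, each starting where the other one ends,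
close up to a two-cycle. -/
theorem exists_isTwoCycle {n : ℕ} {f₁ f₂ : EuclideanSpace ℝ (Fin n) → EuclideanSpace ℝ (Fin n)}
    {κ l : ℝ} (hκ : 0 < κ) (hl : 0 < l) {y z : ℝ → EuclideanSpace ℝ (Fin n)}
    (hy : IsIntegralCurveOn y (fun _ => f₁) (Icc 0 κ))
    (hz : IsIntegralCurveOn z (fun _ => f₂) (Icc 0 l))
    (hyz : z 0 = y κ) (hzy : z l = y 0) :
    ∃ x, IsTwoCycle f₁ f₂ κ (κ + l) x ∧ ∀ t, x t ∈ y '' Icc 0 κ ∪ z '' Icc 0 l := by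
  have hδ : 0 < κ + l := add_pos hκ hl
  have : Fact (0 < κ + l) := ⟨hδ⟩
  set c : ℝ → EuclideanSpace ℝ (Fin n) := fun t => if t ≤ κ then y t else z (t - κ) with hc
  have hc1 : ∀ t ≤ κ, c t = y t := fun t ht => if_pos ht
  have hc2 : ∀ t, κ ≤ t → c t = z (t - κ) := fun t ht => by
    rcases ht.eq_or_lt with rfl | ht
    · simp [hc, hyz]
    · exact if_neg ht.not_ge
  have hz' : IsIntegralCurveOn (fun t => z (t - κ)) (fun _ => f₂) (Icc κ (κ + l)) := fun t ht => by
    have hm : MapsTo (fun u => u - κ) (Icc κ (κ + l)) (Icc 0 l) := fun u hu =>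
      ⟨by linarith [hu.1], by linarith [hu.2]⟩
    simpa only [one_smul] using! HasDerivWithinAt.scomp (h := fun u => u - κ) t (hz (t - κ) (hm ht))
      ((hasDerivWithinAt_id t _).sub_const κ) hm
  have hd1 : IsIntegralCurveOn c (fun _ => f₁) (Icc 0 κ) := fun t ht => by
    rw [hc1 t ht.2]
    exact (hy t ht).congr (fun u hu => hc1 u hu.2) (hc1 t ht.2)
  have hd2 : IsIntegralCurveOn c (fun _ => f₂) (Icc κ (κ + l)) := fun t ht => by
    rw [hc2 t ht.1]
    exact (hz' t ht).congr (fun u hu => hc2 u hu.1) (hc2 t ht.1)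
  have hends : c 0 = c (κ + l) := by
    rw [hc1 0 hκ.le, hc2 _ (by linarith), add_sub_cancel_left, hzy]
  have hcont : ContinuousOn c (Icc 0 (κ + l)) := by
    rw [← Icc_union_Icc_eq_Icc hκ.le (le_add_of_nonneg_right hl.le)]
    exact ContinuousOn.union_of_isClosed (HasDerivWithinAt.continuousOn hd1)
      (HasDerivWithinAt.continuousOn hd2) isClosed_Icc isClosed_Icc
  have hrange : ∀ t ∈ Icc 0 (κ + l), c t ∈ y '' Icc 0 κ ∪ z '' Icc 0 l := fun t ht => by
    rcases le_total t κ with h | h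
    · exact .inl ⟨t, ⟨ht.1, h⟩, (hc1 t h).symm⟩
    · exact .inr ⟨t - κ, ⟨by linarith, by linarith [ht.2]⟩, (hc2 t h).symm⟩
  set x : ℝ → EuclideanSpace ℝ (Fin n) := fun t => AddCircle.liftIco (κ + l) 0 c t
  have hx : ∀ t ∈ Icc 0 (κ + l), x t = c t := fun t ht => by
    rcases ht.2.eq_or_lt with rfl | h
    · have : x (κ + l) = x 0 := by
        simp only [x, AddCircle.coe_period, AddCircle.coe_zero]
      rw [this, ← hends]
      exact AddCircle.liftIco_zero_coe_apply ⟨le_rfl, hδ⟩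
    · exact AddCircle.liftIco_zero_coe_apply ⟨ht.1, h⟩
  have hs1 : Icc 0 κ ⊆ Icc 0 (κ + l) := Icc_subset_Icc_right (by linarith)
  have hs2 : Icc κ (κ + l) ⊆ Icc 0 (κ + l) := Icc_subset_Icc_left hκ.le
  refine ⟨x, ⟨hκ, by linarith, ?_, fun t => by simp [x], fun t ht => ?_, fun t ht => ?_⟩,
    fun t => ?_⟩
  · exact (AddCircle.liftIco_zero_continuous hends hcont).comp (AddCircle.continuous_mk' _)
  · rw [hx t (hs1 ht)]
    exact (hd1 t ht).congr (fun u hu => hx u (hs1 hu)) (hx t (hs1 ht))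
  · rw [hx t (hs2 ht)]
    exact (hd2 t ht).congr (fun u hu => hx u (hs2 hu)) (hx t (hs2 ht))
  · obtain ⟨b, hb, hbt⟩ := AddCircle.eq_coe_Ico (t : AddCircle (κ + l))
    have : x t = c b := by
      simp only [x, ← hbt]
      exact AddCircle.liftIco_zero_coe_apply hb
    rw [this]
    exact hrange b (Ico_subset_Icc_self hb)

theorem theorem2 (n : ℕ) (f₁ f₂ : EuclideanSpace ℝ (Fin n) → EuclideanSpace ℝ (Fin n))
    (hf₁ : ContDiff ℝ 1 f₁) (hf₂ : ContDiff ℝ 1 f₂)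
    (x₀ : EuclideanSpace ℝ (Fin n)) (hx₀ : IsStasisPoint f₁ f₂ x₀)
    (k₁ k₂ : ℝ) (hk₁ : 0 < k₁) (hk₂ : 0 < k₂)
    (hk : k₁ • f₁ x₀ + k₂ • f₂ x₀ = 0)
    (hdet : (fderiv ℝ (fun x => k₁ • f₁ x + k₂ • f₂ x) x₀).det ≠ 0) :
    ∀ ε > 0, ∃ (κ δ : ℝ) (x : ℝ → EuclideanSpace ℝ (Fin n)),
      IsTwoCycle f₁ f₂ κ δ x ∧ δ < ε ∧ ∀ t : ℝ, dist (x t) x₀ < ε := by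
  intro ε hε
  obtain ⟨Φ, r₁, hr₁, T₁, hT₁, hΦ, hΦE⟩ := hf₁.contDiffAt (x := x₀).exists_flow_isEulerStepAt
  obtain ⟨Ψ, r₂, hr₂, T₂, hT₂, hΨ, hΨE⟩ := hf₂.contDiffAt (x := x₀).exists_flow_isEulerStepAt
  have hstep := (hΨE.comp_mul_left hk₂.le).comp (hΦE.comp_mul_left hk₁.le)
  have hfd : fderiv ℝ (fun x => k₁ • f₁ x + k₂ • f₂ x) x₀
      = k₁ • fderiv ℝ f₁ x₀ + k₂ • fderiv ℝ f₂ x₀ := by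
    have h₁ := (hf₁.differentiable one_ne_zero x₀).hasFDerivAt
    have h₂ := (hf₂.differentiable one_ne_zero x₀).hasFDerivAt
    exact ((h₁.const_smul k₁).add (h₂.const_smul k₂)).fderiv
  obtain ⟨B, hB⟩ : ∃ B : EuclideanSpace ℝ (Fin n) ≃L[ℝ] EuclideanSpace ℝ (Fin n),
      (B : EuclideanSpace ℝ (Fin n) →L[ℝ] EuclideanSpace ℝ (Fin n))
        = k₁ • fderiv ℝ f₁ x₀ + k₂ • fderiv ℝ f₂ x₀ :=
    ⟨_, (ContinuousLinearMap.coe_toContinuousLinearEquivOfDetNeZero _ hdet).trans hfd⟩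
  rw [hk, ← hB] at hstep
  -- starting points and times for which both arcs stay in `ball x₀ ε`, and the first one ends in
  -- the domain of the second flow
  obtain ⟨τ₂, hτ₂, V₂, hV₂, hin₂⟩ := hΨE.exists_forall_mem (ball_mem_nhds x₀ hε)
  obtain ⟨τ₁, hτ₁, V₁, hV₁, hin₁⟩ := hΦE.exists_forall_mem
    (inter_mem (ball_mem_nhds x₀ hε) (inter_mem hV₂ (closedBall_mem_nhds x₀ hr₂)))
  obtain ⟨ρ, hρ, hρV⟩ := nhds_basis_closedBall.mem_iff.1
    (inter_mem hV₁ (closedBall_mem_nhds x₀ hr₁))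
  have hsmall : ∀ k : ℝ, ∀ b > 0, ∀ᶠ s in 𝓝[>] (0 : ℝ), k * s < b := fun k b hb => by
    have : Tendsto (fun s : ℝ => k * s) (𝓝[>] 0) (𝓝 0) := by
      simpa using ((continuous_const_mul k).tendsto 0).mono_left nhdsWithin_le_nhds
    exact this.eventually_lt_const hb
  obtain ⟨s, ⟨p, hp, hfix⟩, hs0, hsε, hs₁, hs₂, hsT₁, hsT₂⟩ :=
    ((hstep.eventually_exists_fixedPt hρ).and <| eventually_mem_nhdsWithin.and <|
      (hsmall (k₁ + k₂) ε hε).and <| (hsmall k₁ τ₁ hτ₁).and <| (hsmall k₂ τ₂ hτ₂).and <|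
      (hsmall k₁ T₁ hT₁).and (hsmall k₂ T₂ hT₂)).exists
  have hs0 : 0 < s := hs0
  obtain ⟨hpV, hpr⟩ := hρV hp
  have hκ : 0 < k₁ * s := mul_pos hk₁ hs0
  have hl : 0 < k₂ * s := mul_pos hk₂ hs0
  have harc₁ : ∀ t ∈ Icc 0 (k₁ * s), Φ t p ∈ ball x₀ ε ∩ (V₂ ∩ closedBall x₀ r₂) := fun t ht =>
    hin₁ t ⟨ht.1, ht.2.trans hs₁.le⟩ p hpV
  obtain ⟨-, hqV, hqr⟩ := harc₁ (k₁ * s) ⟨hκ.le, le_rfl⟩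
  obtain ⟨x, hx, hmem⟩ := exists_isTwoCycle hκ hl
    ((hΦ p hpr).2.mono (Icc_subset_Icc_right hsT₁.le))
    ((hΨ _ hqr).2.mono (Icc_subset_Icc_right hsT₂.le)) (hΨ _ hqr).1
    (hfix.trans (hΦ p hpr).1.symm)
  refine ⟨k₁ * s, k₁ * s + k₂ * s, x, hx, by linarith, fun t => ?_⟩
  rcases hmem t with ⟨u, hu, hut⟩ | ⟨u, hu, hut⟩
  · rw [← hut]
    exact (harc₁ u hu).1
  · rw [← hut]
    exact hin₂ u ⟨hu.1, hu.2.trans hs₂.le⟩ _ hqV
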